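/- Let $N\ge 2$ be even, $a\in\mathbb Z$ coprime to $N$ and $L\ge 1$. On a $\mathbb Z_N$ qudit with basis $|s\rangle$, $s\in\mathbb Z_N$, let $X|s\rangle=|s+1\rangle$, $Z|s\rangle=e^{2\pi i s/N}|s\rangle$, $C|s\rangle=|-s\rangle$ (so $CXC^\dagger=X^\dagger$, $CZC^\dagger=Z^\dagger$). On a periodic chain of $L$ such qudits put $$\mathcal U_x=\bigotimes_{j=1}^{L}X_j^{a^{j-1}},\qquad \mathcal U_c=\bigotimes_{j=1}^{L}C_jZ_j .$$ Write $D_{2N}=\langle x,c\mid x^N=c^2=1,\ cxc^{-1}=x^{-1}\rangle$ and let $T$ be the endomorphism $T(x)=x^a$, $T(c)=c$. For $g\in D_{2N}$ let $U_{g,j}$ be the one-site operators at site $j$ with $U_{x^i,j}=X^{a^{j-1}i}$ and $U_{cx^i,j}=CZ\,X^{a^{j-1}i}$ ($0\le i<N$). For a function $\omega:D_{2N}\times D_{2N}\to U(1)$ put $\beta(\omega)=\omega(x^{N/2},c)\,\omega(c,x^{N/2})^{-1}$. Cocycles and coboundaries are $U(1)$-valued with trivial action. Then: 1. Modulo global phases,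 $x\mapsto\mathcal U_x$, $c\mapsto\mathcal U_c$ defines an isomorphism from $D_{2N}$ onto the group generated by $\mathcal U_x$ and $\mathcal U_c$; it does so without dividing by phases if and only if $N\mid\sum_{j=1}^{L}a^{j-1}$. Moreover $T$ is an automorphism and $U_{g,j+1}=U_{T(g),j}$. 2. For every site $j\geq 1$, $U_{g,j}U_{h,j}=\nu_j(g,h)U_{gh,j}$ for a 2-cocycle $\nu_j$ with $\beta(\nu_j)=(-1)^{a^{j-1}}=-1$, and $\nu_j$ is not a coboundary: each site carries a nontrivial projective class. 3. For every 2-cocycle $\omega$ on $D_{2N}$, $\beta(\omega)=(-1)^m$ for some $m\in\{0,1\}$, and $\beta(\omega)$ depends only on the class of $\omega$. For every integer $m$ with $\beta(\omega)=(-1)^m$, the pullbacks $\omega_j(g,h)=\omega(T^j(g),T^j(h))$, $j\ge 0$, satisfy $\beta(\omega_j)=(-1)^{ma^j}$, and for each $j\ge1$ the consistency condition $\beta(\omega_j)=\beta(\nu_j)\beta(\omega_{j-1})$ is equivalent to $m(a-1)\equiv1\pmod 2$. This congruence has no integer solution $m$. Consequently, for no site $j\ge 1$ do there exist 2-cocycles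 $\omega_{j-1},\omega_j$ with $\omega_j=\nu_j\,\omega_{j-1}$ and $\omega_j(g,h)=\omega_{j-1}(T(g),T(h))$ up to coboundaries. 4. There is no symmetric injective matrix product state: there are no bond dimension $D$ and matrices $A^s\in M_D(\mathbb C)$, $s\in\mathbb Z_N$, such that (i) the transfer matrix $\mathbb E=\sum_s A^s\otimes (A^s)^*$ has a nonzero eigenvalue of algebraic multiplicity one whose modulus is strictly larger than that of every other eigenvalue, and (ii) for every $k\ge1$ the vector $\psi_{kL}=\sum_{s_1,\dots,s_{kL}}\operatorname{Tr}(A^{s_1}\cdots A^{s_{kL}})|s_1\dots s_{kL}\rangle$ satisfies $\mathcal U_x^{\otimes k}\psi_{kL}=e^{i\theta_k}\psi_{kL}$ and $\mathcal U_c^{\otimes k}\psi_{kL}=e^{i\theta'_k}\psi_{kL}$ for some real $\theta_k,\theta_k'$. -/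

import Mathlib

open scoped Matrix Kronecker

noncomputable section

namespace DihedralLSM

/-! ### The clock, shift and charge-conjugation operators on a `ℤ_N` qudit

The basis states `|s⟩` of one qudit are indexed by `s : ZMod N`. -/

section Qudit

variable (N : ℕ) [NeZero N]

/-- The shift operator, `X |s⟩ = |s + 1⟩`. -/
def shift : Matrix.unitaryGroup (ZMod N) ℂ :=
  ⟨Matrix.of fun s t => if s = t + 1 then 1 else 0, by
    rw [Matrix.mem_unitaryGroup_iff]
    ext s t
    have h : ∀ x : ZMod N, (s = x + 1) ↔ x = s - 1 := fun x =>
      ⟨fun h => by rw [h]; ring, fun h => by rw [h]; ring⟩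
    rw [Matrix.mul_apply, Finset.sum_eq_single (s - 1)]
    · simp [Matrix.star_apply, Matrix.one_apply, @eq_comm _ t s]
    · intro x _ hx
      simp [h, hx]
    · simp⟩

/-- The clock operator, `Z |s⟩ = exp(2πi s / N) |s⟩`. -/
def clock : Matrix.unitaryGroup (ZMod N) ℂ :=
  ⟨Matrix.diagonal fun s => ((ZMod.toCircle s : Circle) : ℂ), by
    rw [Matrix.mem_unitaryGroup_iff, Matrix.star_eq_conjTranspose,
      Matrix.diagonal_conjTranspose, Matrix.diagonal_mul_diagonal]
    ext s t
    by_cases hst : s = t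
    · subst hst
      simp [← Circle.coe_inv_eq_conj]
    · simp [hst]⟩

/-- Charge conjugation, `C |s⟩ = |-s⟩`. -/
def chargeConj : Matrix.unitaryGroup (ZMod N) ℂ :=
  ⟨Matrix.of fun s t => if s = -t then 1 else 0, by
    rw [Matrix.mem_unitaryGroup_iff]
    ext s t
    have h : ∀ x : ZMod N, (s = -x) ↔ x = -s := fun x =>
      ⟨fun h => by rw [h]; ring, fun h => by rw [h]; ring⟩
    rw [Matrix.mul_apply, Finset.sum_eq_single (-s)]
    · simp [Matrix.star_apply, Matrix.one_apply, @eq_comm _ t s]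
    · intro x _ hx
      simp [h, hx]
    · simp⟩

/-- Charge conjugation maps `X` to `X†`. -/
theorem chargeConj_shift :
    chargeConj N * shift N * (chargeConj N)⁻¹ = (shift N)⁻¹ := by
  rw [mul_inv_eq_iff_eq_mul, eq_inv_mul_iff_mul_eq]
  ext s t
  have h1 : ∀ x : ZMod N, (s = x + 1) ↔ x = s - 1 := fun x =>
    ⟨fun h => by rw [h]; ring, fun h => by rw [h]; ring⟩
  have h2 : -1 + -t = s - 1 ↔ s = -t :=
    ⟨fun h => by rw [eq_sub_iff_add_eq] at h; rw [← h]; ring, fun h => by rw [h]; ring⟩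
  simp [shift, chargeConj, Matrix.mul_apply, h1, h2]

/-- Charge conjugation maps `Z` to `Z†`. -/
theorem chargeConj_clock :
    chargeConj N * clock N * (chargeConj N)⁻¹ = (clock N)⁻¹ := by
  rw [mul_inv_eq_iff_eq_mul, eq_inv_mul_iff_mul_eq]
  ext s t
  by_cases h : s = -t
  · subst h
    simp [clock, chargeConj, Matrix.mul_apply, Matrix.diagonal_apply, ← Circle.coe_mul,
      ← AddChar.map_add_eq_mul]
  · simp [clock, chargeConj, Matrix.mul_apply, Matrix.diagonal_apply, h]

end Qudit

/-! ### Tensor product operators on a chain -/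

/-- The tensor product `⨂ᵢ Uᵢ` of one-site unitaries, acting on the chain with `n` sites whose
product basis is indexed by the configurations `Fin n → q`. -/
def tensorUnitary {q : Type*} [Fintype q] [DecidableEq q] {n : ℕ}
    (U : Fin n → Matrix.unitaryGroup q ℂ) : Matrix.unitaryGroup (Fin n → q) ℂ :=
  ⟨Matrix.of fun s t => ∏ i, (U i : Matrix q q ℂ) (s i) (t i), by
    rw [Matrix.mem_unitaryGroup_iff]
    ext s t
    have h : ∀ i, ∑ x, (U i : Matrix q q ℂ) (s i) x * star ((U i : Matrix q q ℂ) (t i) x)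
        = if s i = t i then 1 else 0 := by
      intro i
      have := congrFun (congrFun (Matrix.mem_unitaryGroup_iff.mp (U i).2) (s i)) (t i)
      simpa [Matrix.mul_apply, Matrix.star_apply, Matrix.one_apply] using this
    have key : ∑ x : Fin n → q, ∏ i, ((U i : Matrix q q ℂ) (s i) (x i) *
        star ((U i : Matrix q q ℂ) (t i) (x i))) = ∏ i, if s i = t i then (1 : ℂ) else 0 := by
      rw [← Finset.prod_congr rfl fun i _ => h i, Finset.prod_univ_sum, Fintype.piFinset_univ]
    simp only [Matrix.mul_apply, Matrix.star_apply, Matrix.of_apply, Matrix.one_apply, star_prod,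
      ← Finset.prod_mul_distrib, key]
    by_cases hst : s = t
    · simp [hst]
    · obtain ⟨i, hi⟩ := Function.ne_iff.mp hst
      rw [if_neg hst]
      exact Finset.prod_eq_zero (Finset.mem_univ i) (if_neg hi)⟩

/-- The group of global phases `z • 1`, `|z| = 1`, inside a unitary group. -/
def phases (ι : Type*) [Fintype ι] [DecidableEq ι] : Subgroup (Matrix.unitaryGroup ι ℂ) where
  carrier := {u | ∃ z : Circle, (u : Matrix ι ι ℂ) = (z : ℂ) • 1}
  one_mem' := ⟨1, by simp⟩
  mul_mem' := by
    rintro u v ⟨z, hz⟩ ⟨w, hw⟩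
    exact ⟨z * w, by simp [hz, hw, smul_smul, mul_comm]⟩
  inv_mem' := by
    rintro u ⟨z, hz⟩
    refine ⟨z⁻¹, ?_⟩
    rw [Matrix.UnitaryGroup.inv_val, hz, star_smul, star_one, Circle.coe_inv_eq_conj]
    rfl

instance phases_normal (ι : Type*) [Fintype ι] [DecidableEq ι] : (phases ι).Normal where
  conj_mem := by
    rintro u ⟨z, hz⟩ g
    refine ⟨z, ?_⟩
    have h : (g : Matrix ι ι ℂ) * star (g : Matrix ι ι ℂ) = 1 :=
      Matrix.mem_unitaryGroup_iff.mp g.2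
    simp [Matrix.UnitaryGroup.inv_val, hz, h]

/-! ### The dihedral symmetry with exponentially modulated rotations

Sites are counted from `0`, so the site `j` of the code is the `(j + 1)`-st site of the chain. -/

section Symmetry

variable (N : ℕ) [NeZero N] (a : ℤ)

/-- The operator `∏ X_i ^ (a ^ i)` on `n` sites, where the exponents `1, a, …, a ^ (L - 1)` of the
unit cell with `L` sites are repeated periodically. -/
def symX (L n : ℕ) : Matrix.unitaryGroup (Fin n → ZMod N) ℂ :=
  tensorUnitary fun i => shift N ^ (a ^ ((i : ℕ) % L))

/-- The operator `∏ C_i Z_i` on `n` sites. -/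
def symC (n : ℕ) : Matrix.unitaryGroup (Fin n → ZMod N) ℂ :=
  tensorUnitary fun _ => chargeConj N * clock N

/-- The action of the dihedral group of order `2 N` on the site `j`: the rotation generator
`x = r 1` acts by `X ^ (a ^ j)`, the reflection `c = sr 0` acts by `C Z`, and
`c x ^ i = sr i` acts by the product of the two operators. -/
def siteOp (j : ℕ) : DihedralGroup N → Matrix.unitaryGroup (ZMod N) ℂ
  | .r i => shift N ^ (a ^ j * (i.val : ℤ))
  | .sr i => (chargeConj N * clock N) * shift N ^ (a ^ j * (i.val : ℤ))

/-- The endomorphism `x ↦ x ^ a`, `c ↦ c` of the dihedral group. -/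
def translation : DihedralGroup N →* DihedralGroup N where
  toFun
    | .r i => .r (a * i)
    | .sr i => .sr (a * i)
  map_one' := by
    change DihedralGroup.r ((a : ZMod N) * 0) = DihedralGroup.r 0
    rw [mul_zero]
  map_mul' := by
    rintro (i | i) (j | j) <;> simp [mul_add, mul_sub]

end Symmetry

/-! ### Projective representations and `U(1)`-valued 2-cocycles -/

section Cocycle

variable {G : Type*} [Group G]

/-- `ν` is the factor system of the family `U`: `U_g U_h = ν(g,h) U_{gh}`. -/
def IsFactorSystem {q : Type*} [Fintype q] [DecidableEq q]
    (U : G → Matrix.unitaryGroup q ℂ) (ν : G × G → Circle) : Prop :=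
  ∀ g h, (U g : Matrix q q ℂ) * (U h : Matrix q q ℂ) = (ν (g, h) : ℂ) • (U (g * h) : Matrix q q ℂ)

/-- 2-cocycles with values in `U(1)`, on which `G` acts trivially. -/
def IsCocycle (ω : G × G → Circle) : Prop :=
  letI : SMul G Circle := ⟨fun _ z => z⟩
  groupCohomology.IsMulCocycle₂ ω

/-- 2-coboundaries with values in `U(1)`, on which `G` acts trivially. -/
def IsCoboundary (ω : G × G → Circle) : Prop :=
  letI : SMul G Circle := ⟨fun _ z => z⟩
  groupCohomology.IsMulCoboundary₂ ω

/-- Equality up to coboundaries. -/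
def Cohomologous (ω ω' : G × G → Circle) : Prop := IsCoboundary (ω / ω')

/-- The pullback `(g, h) ↦ ω(T g, T h)` of a 2-cochain. -/
def pullback (T : G → G) (ω : G × G → Circle) : G × G → Circle :=
  fun p => ω (T p.1, T p.2)

/-- The phase `ω(x^{N/2}, c) ω(c, x^{N/2})⁻¹` of a 2-cochain on the dihedral group. -/
def halfTurnPhase {N : ℕ} (ω : DihedralGroup N × DihedralGroup N → Circle) : ℂ :=
  let x : DihedralGroup N := .r ((N / 2 : ℕ) : ZMod N)
  let c : DihedralGroup N := .sr 0
  ((ω (x, c) / ω (c, x) : Circle) : ℂ)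

end Cocycle

/-! ### Matrix product states -/

section MPS

variable {q : Type*} [Fintype q] {D : ℕ}

/-- The translation invariant periodic matrix product state on `n` sites:
`ψ(s₁, …, sₙ) = Tr (A^{s₁} ⋯ A^{sₙ})`. -/
def mpsState (A : q → Matrix (Fin D) (Fin D) ℂ) (n : ℕ) : (Fin n → q) → ℂ :=
  fun s => (List.ofFn fun i => A (s i)).prod.trace

/-- The transfer matrix `𝔼 = ∑ₛ A^s ⊗ (A^s)^*`. -/
def transferMatrix (A : q → Matrix (Fin D) (Fin D) ℂ) :
    Matrix (Fin D × Fin D) (Fin D × Fin D) ℂ :=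
  ∑ s, A s ⊗ₖ (A s).map star

/-- Injectivity: the transfer matrix has a nonzero, nondegenerate (algebraically simple) dominant
eigenvalue, which is separated from all other eigenvalues by a gap in modulus. -/
def IsInjectiveMPS (A : q → Matrix (Fin D) (Fin D) ℂ) : Prop :=
  ∃ lam : ℂ, lam ≠ 0 ∧ (transferMatrix A).charpoly.rootMultiplicity lam = 1 ∧
    ∀ μ : ℂ, (transferMatrix A).charpoly.IsRoot μ → μ ≠ lam → ‖μ‖ < ‖lam‖

/-- `U ψ = e^{iθ} ψ` for some phase `e^{iθ}`. -/
def IsInvariantUpToPhase {ι : Type*} [Fintype ι] [DecidableEq ι]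
    (U : Matrix.unitaryGroup ι ℂ) (ψ : ι → ℂ) : Prop :=
  ∃ z : Circle, (U : Matrix ι ι ℂ) *ᵥ ψ = (z : ℂ) • ψ

/-- The matrix product state of `A` is symmetric under the two generators with unit cell of `L`
sites: for every `k ≥ 1`, the state on `k L` sites is invariant up to a phase under the `k`-fold
periodic extension of each of them. -/
def IsSymmetricMPS (N : ℕ) [NeZero N] (a : ℤ) (L : ℕ)
    (A : ZMod N → Matrix (Fin D) (Fin D) ℂ) : Prop :=
  ∀ k : ℕ, 0 < k →
    IsInvariantUpToPhase (symX N a L (k * L)) (mpsState A (k * L)) ∧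
    IsInvariantUpToPhase (symC N (k * L)) (mpsState A (k * L))

end MPS

end DihedralLSM

end

/-!
Let `x = .r 1` and `c = .sr 0`, and write `h = x ^ (N / 2)`, which for even `N` commutes with `c`.
In a projective representation the operators of a commuting pair commute up to a phase, which
depends only on the cohomology class of the factor system. For the pair `(h, c)` this phase is `-1`
at every site. As `a` is odd, `T` fixes `h` and `c`, so translation cannot absorb that sign.

For a matrix product state, `⟨ψₙ, U^{⊗n} ψₙ⟩` is the trace of the `n`-th power of a twisted
transfer matrix. Suppose the operators of `h` and `c` act on `ψₙ` by phases whenever `L ∣ n`. Along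
these lengths the traces grow like a single power `r ^ n`, and this alone forces the twisted
transfer matrix to have exactly one eigenvalue of largest modulus. Hence the same growth holds along
all lengths: `ψₙ` becomes an approximate eigenvector of both symmetries for every large `n`. For odd
`n` these two operators anticommute, which is a contradiction.
-/

namespace DihedralLSM

/-! ### Traces of powers and dominant eigenvalues -/

section TracePow

open Module Module.End

variable {K V : Type*} [Field K] [AddCommGroup V] [Module K V] [FiniteDimensional K V]

theorem trace_pow_of_isNilpotent_sub_algebraMap (f : End K V) (μ : K)
    (h : IsNilpotent (f - algebraMap K (End K V) μ)) (n : ℕ) :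
    LinearMap.trace K V (f ^ n) = finrank K V * μ ^ n := by
  induction n with
  | zero => simp
  | succ n ih =>
    rw [pow_succ, mul_eq_comp, LinearMap.trace_comp_eq_mul_of_commute_of_isNilpotent μ
      (Commute.pow_left (Commute.refl f) n) h, ih]
    ring

theorem trace_pow_eq_sum_roots_charpoly [IsAlgClosed K] (f : End K V) (n : ℕ) :
    LinearMap.trace K V (f ^ n) = (f.charpoly.roots.map (· ^ n)).sum := by
  classical
  have hfin : {μ | f.maxGenEigenspace μ ≠ ⊥}.Finite :=
    WellFoundedGT.finite_ne_bot_of_iSupIndep f.independent_maxGenEigenspace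
  have hmaps (μ : K) : Set.MapsTo f (f.maxGenEigenspace μ) (f.maxGenEigenspace μ) :=
    f.mapsTo_maxGenEigenspace_of_comm (Commute.refl _) μ
  have hmaps_pow (μ : K) : Set.MapsTo (f ^ n) (f.maxGenEigenspace μ) (f.maxGenEigenspace μ) :=
    f.mapsTo_maxGenEigenspace_of_comm (Commute.pow_right (Commute.refl f) n) μ
  have htrace (μ : K) : LinearMap.trace K _ ((f ^ n).restrict (hmaps_pow μ)) =
      f.charpoly.roots.count μ • μ ^ n := by
    rw [← pow_restrict n (hmaps μ), trace_pow_of_isNilpotent_sub_algebraMap _ μ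
      (f.isNilpotent_restrict_maxGenEigenspace_sub_algebraMap μ),
      LinearMap.finrank_maxGenEigenspace_eq, Polynomial.count_roots, nsmul_eq_mul]
  have hsupport : hfin.toFinset = f.charpoly.roots.toFinset := by
    ext μ
    rw [Set.Finite.mem_toFinset, Set.mem_ofPred_eq, Multiset.mem_toFinset,
      ← Multiset.count_pos, Polynomial.count_roots, ← LinearMap.finrank_maxGenEigenspace_eq,
      finrank_pos_iff, Submodule.nontrivial_iff_ne_bot]
  have hinternal := DirectSum.isInternal_submodule_of_iSupIndep_of_iSup_eq_top
    f.independent_maxGenEigenspace f.iSup_maxGenEigenspace_eq_top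
  rw [LinearMap.trace_eq_sum_trace_restrict' hinternal hfin hmaps_pow, hsupport,
    Finset.sum_multiset_map_count]
  exact Finset.sum_congr rfl fun μ _ => htrace μ

theorem matrix_trace_pow_eq_sum_roots_charpoly {ι : Type*} [Fintype ι] [DecidableEq ι]
    [IsAlgClosed K] (M : Matrix ι ι K) (n : ℕ) :
    (M ^ n).trace = (M.charpoly.roots.map (· ^ n)).sum := by
  rw [← Matrix.charpoly_toLin', ← trace_pow_eq_sum_roots_charpoly, ← Matrix.toLin'_pow,
    Matrix.trace_toLin'_eq]

end TracePow

section PowerSums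

open Filter Topology

/-- A multiset of complex numbers, usually the spectrum of a matrix counted with algebraic
multiplicities, has exactly one element of modulus `r`, and all others have smaller modulus. -/
def HasDominantModulus (s : Multiset ℂ) (r : ℝ) : Prop :=
  ∃ (z : ℂ) (t : Multiset ℂ), s = z ::ₘ t ∧ ‖z‖ = r ∧ ∀ w ∈ t, ‖w‖ < r

theorem HasDominantModulus.of_map_pow {s : Multiset ℂ} {r : ℝ} {L : ℕ} (hr : 0 ≤ r) (hL : L ≠ 0)
    (h : HasDominantModulus (s.map (· ^ L)) (r ^ L)) : HasDominantModulus s r := by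
  obtain ⟨_, _, hs, hz, ht⟩ := h
  obtain ⟨z, hzs, rfl, rfl⟩ := (Multiset.map_eq_cons _ _ _ _).mpr hs
  refine ⟨z, s.erase z, (Multiset.cons_erase hzs).symm, ?_, fun w hw => ?_⟩
  · rwa [norm_pow, pow_left_inj₀ (norm_nonneg z) hr hL] at hz
  · have := ht _ (Multiset.mem_map_of_mem _ hw)
    rwa [norm_pow, pow_lt_pow_iff_left₀ (norm_nonneg w) hr hL] at this

theorem frequently_forall_pow_near_one {ι : Type*} [Finite ι] (u : ι → Circle) {ε : ℝ}
    (hε : 0 < ε) : ∃ᶠ n : ℕ in atTop, ∀ i, ‖((u i ^ n : Circle) : ℂ) - 1‖ < ε := by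
  refine (mapClusterPt_one_atTop_pow u).frequently
    (p := fun v => ∀ i, ‖((v i : Circle) : ℂ) - 1‖ < ε) (IsOpen.mem_nhds ?_ fun _ => by simpa)
  rw [Set.ofPred_forall]
  exact isOpen_iInter_of_finite fun i => isOpen_lt (by fun_prop) continuous_const

theorem frequently_forall_mul_norm_pow_le_re_pow {ι : Type*} [Finite ι] (z : ι → ℂ) {c : ℝ}
    (hc : c < 1) : ∃ᶠ n : ℕ in atTop, ∀ i, c * ‖z i‖ ^ n ≤ (z i ^ n).re := by
  refine (frequently_forall_pow_near_one (fun i => Circle.exp (z i).arg) (sub_pos.mpr hc)).mono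
    fun n hn i => ?_
  set u : ℂ := ((Circle.exp (z i).arg ^ n : Circle) : ℂ) with hu
  have hpolar : z i ^ n = (‖z i‖ ^ n : ℝ) * u := by
    rw [hu, Circle.coe_pow, Circle.coe_exp, Complex.ofReal_pow, ← mul_pow,
      Complex.norm_mul_exp_arg_mul_I]
  have hre : c ≤ u.re := by
    have := (Complex.abs_re_le_norm (u - 1)).trans (hn i).le
    rw [Complex.sub_re, Complex.one_re, abs_le] at this
    linarith
  rw [hpolar, Complex.re_ofReal_mul, mul_comm]
  gcongr

theorem frequently_mul_sum_norm_pow_le_norm_sum_pow (s : Multiset ℂ) {c : ℝ} (hc : c < 1) :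
    ∃ᶠ n : ℕ in atTop,
      c * (s.map fun z => ‖z‖ ^ n).sum ≤ ‖(s.map fun z => z ^ n).sum‖ := by
  classical
  refine (frequently_forall_mul_norm_pow_le_re_pow (fun z : s.toFinset => (z : ℂ)) hc).mono
    fun n hn => ?_
  refine le_trans ?_ (Complex.re_le_norm _)
  rw [← Complex.coe_reAddGroupHom, map_multiset_sum, Multiset.map_map, ← Multiset.sum_map_mul_left]
  exact Multiset.sum_map_le_sum_map _ _ fun z hz => hn ⟨z, Multiset.mem_toFinset.mpr hz⟩

theorem tendsto_norm_sum_pow_div_zero {s : Multiset ℂ} {r : ℝ} (h : ∀ z ∈ s, ‖z‖ < r) :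
    Tendsto (fun n : ℕ => ‖(s.map fun z => z ^ n).sum‖ / r ^ n) atTop (𝓝 0) := by
  induction s using Multiset.induction_on with
  | empty => simp
  | cons z s ih =>
    have hzr : ‖z‖ < r := h z (Multiset.mem_cons_self z s)
    have hr : 0 < r := (norm_nonneg z).trans_lt hzr
    have hz : Tendsto (fun n : ℕ => (‖z‖ / r) ^ n) atTop (𝓝 0) :=
      tendsto_pow_atTop_nhds_zero_of_lt_one (by positivity) ((div_lt_one hr).mpr hzr)
    have hsum := hz.add (ih fun w hw => h w (Multiset.mem_cons_of_mem hw))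
    rw [add_zero] at hsum
    refine squeeze_zero (fun n => by positivity) (fun n => ?_) hsum
    rw [Multiset.map_cons, Multiset.sum_cons, div_pow, ← norm_pow, ← add_div]
    gcongr
    exact norm_add_le _ _

theorem HasDominantModulus.tendsto_norm_sum_pow_div {s : Multiset ℂ} {r : ℝ} (hr : 0 < r)
    (h : HasDominantModulus s r) :
    Tendsto (fun n : ℕ => ‖(s.map fun z => z ^ n).sum‖ / r ^ n) atTop (𝓝 1) := by
  obtain ⟨z, t, rfl, rfl, ht⟩ := h
  rw [tendsto_iff_norm_sub_tendsto_zero]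
  refine squeeze_zero (fun _ => norm_nonneg _) (fun n => ?_) (tendsto_norm_sum_pow_div_zero ht)
  rw [div_sub_one (by positivity), norm_div, Real.norm_eq_abs, norm_pow, norm_norm,
    Multiset.map_cons, Multiset.sum_cons, ← norm_pow]
  gcongr
  simpa using abs_norm_sub_norm_le (z ^ n + (t.map (· ^ n)).sum) (z ^ n)

theorem frequently_sum_norm_pow_lt_two_mul {s : Multiset ℂ} {r : ℝ} (hr : 0 < r)
    (h : Tendsto (fun n : ℕ => ‖(s.map fun z => z ^ n).sum‖ / r ^ n) atTop (𝓝 1)) :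
    ∃ᶠ n : ℕ in atTop, (s.map fun z => ‖z‖ ^ n).sum < 2 * r ^ n := by
  refine ((frequently_mul_sum_norm_pow_le_norm_sum_pow s (c := 3 / 4) (by norm_num)).and_eventually
    (h.eventually_lt_const (u := 3 / 2) (by norm_num))).mono ?_
  rintro n ⟨hle, hlt⟩
  rw [div_lt_iff₀ (by positivity)] at hlt
  linarith

theorem norm_pow_le_sum_norm_pow {s : Multiset ℂ} {z : ℂ} (hz : z ∈ s) (n : ℕ) :
    ‖z‖ ^ n ≤ (s.map fun z => ‖z‖ ^ n).sum := by
  refine Multiset.single_le_sum (fun x hx => ?_) _ (Multiset.mem_map_of_mem (‖·‖ ^ n) hz)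
  obtain ⟨w, -, rfl⟩ := Multiset.mem_map.mp hx
  positivity

/-- At a time when all phases `(z / ‖z‖) ^ n` are close to `1` simultaneously, no cancellation
occurs in the power sum, so its growth bounds the moduli and the number of maximal ones. -/
theorem HasDominantModulus.of_tendsto {s : Multiset ℂ} {r : ℝ} (hr : 0 < r)
    (h : Tendsto (fun n : ℕ => ‖(s.map fun z => z ^ n).sum‖ / r ^ n) atTop (𝓝 1)) :
    HasDominantModulus s r := by
  have hfreq := frequently_sum_norm_pow_lt_two_mul hr h
  have hle (z : ℂ) (hz : z ∈ s) : ‖z‖ ≤ r := by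
    by_contra! hlt
    have hgrow : ∀ᶠ n : ℕ in atTop, 2 < (‖z‖ / r) ^ n :=
      (tendsto_pow_atTop_atTop_of_one_lt ((one_lt_div hr).mpr hlt)).eventually_gt_atTop 2
    obtain ⟨n, hn, hn'⟩ := (hfreq.and_eventually hgrow).exists
    rw [div_pow, lt_div_iff₀ (by positivity)] at hn'
    linarith [norm_pow_le_sum_norm_pow hz n]
  obtain ⟨z, hz, hzr⟩ : ∃ z ∈ s, ‖z‖ = r := by
    by_contra! hne
    exact zero_ne_one (tendsto_nhds_unique
      (tendsto_norm_sum_pow_div_zero fun z hz => (hle z hz).lt_of_ne (hne z hz)) h)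
  obtain ⟨t, rfl⟩ := Multiset.exists_cons_of_mem hz
  refine ⟨z, t, rfl, hzr, fun w hw =>
    (hle w (Multiset.mem_cons_of_mem hw)).lt_of_ne fun hwr => ?_⟩
  obtain ⟨n, hn⟩ := hfreq.exists
  rw [Multiset.map_cons, Multiset.sum_cons, hzr] at hn
  have := norm_pow_le_sum_norm_pow hw n
  rw [hwr] at this
  linarith

theorem hasDominantModulus_iff_tendsto {s : Multiset ℂ} {r : ℝ} (hr : 0 < r) :
    HasDominantModulus s r ↔
      Tendsto (fun n : ℕ => ‖(s.map fun z => z ^ n).sum‖ / r ^ n) atTop (𝓝 1) :=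
  ⟨fun h => h.tendsto_norm_sum_pow_div hr, .of_tendsto hr⟩

variable {ι : Type*} [Fintype ι] [DecidableEq ι]

theorem hasDominantModulus_roots_charpoly_iff_tendsto (M : Matrix ι ι ℂ) {r : ℝ} (hr : 0 < r) :
    HasDominantModulus M.charpoly.roots r ↔
      Tendsto (fun n : ℕ => ‖(M ^ n).trace‖ / r ^ n) atTop (𝓝 1) := by
  simp_rw [hasDominantModulus_iff_tendsto hr, matrix_trace_pow_eq_sum_roots_charpoly]

theorem tendsto_norm_trace_pow_div_of_tendsto_mul (M : Matrix ι ι ℂ) {r : ℝ} (hr : 0 < r) {L : ℕ}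
    (hL : L ≠ 0)
    (h : Tendsto (fun k : ℕ => ‖(M ^ (k * L)).trace‖ / r ^ (k * L)) atTop (𝓝 1)) :
    Tendsto (fun n : ℕ => ‖(M ^ n).trace‖ / r ^ n) atTop (𝓝 1) := by
  rw [← hasDominantModulus_roots_charpoly_iff_tendsto M hr]
  refine .of_map_pow hr.le hL (.of_tendsto (pow_pos hr L) ?_)
  simpa only [Multiset.map_map, Function.comp_def, ← pow_mul, mul_comm L,
    matrix_trace_pow_eq_sum_roots_charpoly] using h

theorem hasDominantModulus_roots_of_rootMultiplicity_eq_one {p : Polynomial ℂ} {z : ℂ}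
    (hz : p.rootMultiplicity z = 1) (h : ∀ w, p.IsRoot w → w ≠ z → ‖w‖ < ‖z‖) :
    HasDominantModulus p.roots ‖z‖ := by
  classical
  have hcount : p.roots.count z = 1 := by rw [Polynomial.count_roots, hz]
  have hmem : z ∈ p.roots := Multiset.count_pos.mp (by omega)
  refine ⟨z, p.roots.erase z, (Multiset.cons_erase hmem).symm, rfl, fun w hw => h w
    (Polynomial.isRoot_of_mem_roots (Multiset.mem_of_mem_erase hw)) ?_⟩
  rintro rfl
  have := Multiset.count_pos.mpr hw
  rw [Multiset.count_erase_self] at this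
  omega

end PowerSums

/-! ### Approximate eigenvectors of isometries -/

section AlmostEigenvectors

variable {𝕜 E : Type*} [RCLike 𝕜] [NormedAddCommGroup E] [InnerProductSpace 𝕜 E]

theorem norm_sub_inner_div_smul_sq (φ v : E) :
    ‖v - (inner 𝕜 φ v / (‖φ‖ : 𝕜) ^ 2) • φ‖ ^ 2 = ‖v‖ ^ 2 - (‖inner 𝕜 φ v‖ / ‖φ‖) ^ 2 := by
  rcases eq_or_ne φ 0 with rfl | hφ
  · simp
  have hφ' : ‖φ‖ ≠ 0 := norm_ne_zero_iff.mpr hφ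
  have hre : RCLike.re (inner 𝕜 v ((inner 𝕜 φ v / (‖φ‖ : 𝕜) ^ 2) • φ)) =
      ‖inner 𝕜 φ v‖ ^ 2 / ‖φ‖ ^ 2 := by
    rw [inner_smul_right, div_mul_eq_mul_div, ← inner_conj_symm v φ, RCLike.mul_conj]
    norm_cast
  rw [@norm_sub_sq 𝕜, hre, norm_smul, norm_div, norm_pow, RCLike.norm_ofReal, abs_norm]
  field_simp
  ring

theorem norm_map_sub_inner_div_smul (T : E →ₗᵢ[𝕜] E) (φ : E) :
    ‖T φ - (inner 𝕜 φ (T φ) / (‖φ‖ : 𝕜) ^ 2) • φ‖ =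
      ‖φ‖ * √(1 - (‖inner 𝕜 φ (T φ)‖ / ‖φ‖ ^ 2) ^ 2) := by
  rcases eq_or_ne φ 0 with rfl | hφ
  · simp
  have hφ' : 0 < ‖φ‖ := norm_pos_iff.mpr hφ
  rw [← Real.sqrt_sq (norm_nonneg (_ - _)), norm_sub_inner_div_smul_sq, T.norm_map,
    ← Real.sqrt_sq hφ'.le, ← Real.sqrt_mul (sq_nonneg _), Real.sqrt_sq hφ'.le]
  congr 1
  field_simp

theorem norm_inner_map_div_le_one (T : E →ₗᵢ[𝕜] E) (φ : E) :
    ‖inner 𝕜 φ (T φ) / (‖φ‖ : 𝕜) ^ 2‖ ≤ 1 := by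
  rw [norm_div, norm_pow, RCLike.norm_ofReal, abs_norm, sq]
  refine div_le_one_of_le₀ ?_ (by positivity)
  simpa using norm_inner_le_norm (𝕜 := 𝕜) φ (T φ)

theorem norm_one_sub_mul_norm_le {P Q : E →ₗᵢ[𝕜] E} {φ : E} {w p q : 𝕜} (hp : ‖p‖ ≤ 1)
    (hq : ‖q‖ ≤ 1) (h : P (Q φ) = w • Q (P φ)) :
    ‖1 - w‖ * ‖φ‖ ≤ 2 * (‖P φ - p • φ‖ + ‖Q φ - q • φ‖) := by
  have hsplit : (1 - w) • Q (P φ) =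
      Q (P φ - p • φ) + p • (Q φ - q • φ) - P (Q φ - q • φ) - q • (P φ - p • φ) := by
    simp only [map_sub, map_smul, h]
    module
  calc ‖1 - w‖ * ‖φ‖ = ‖(1 - w) • Q (P φ)‖ := by rw [norm_smul, Q.norm_map, P.norm_map]
    _ ≤ ‖P φ - p • φ‖ + ‖p‖ * ‖Q φ - q • φ‖ + ‖Q φ - q • φ‖ + ‖q‖ * ‖P φ - p • φ‖ := by
      rw [hsplit, ← norm_smul, ← norm_smul, ← Q.norm_map (P φ - p • φ),
        ← P.norm_map (Q φ - q • φ)]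
      exact (norm_sub_le _ _).trans (add_le_add_left ((norm_sub_le _ _).trans
        (add_le_add_left (norm_add_le _ _) _)) _)
    _ ≤ ‖P φ - p • φ‖ + 1 * ‖Q φ - q • φ‖ + ‖Q φ - q • φ‖ + 1 * ‖P φ - p • φ‖ := by
      gcongr
    _ = 2 * (‖P φ - p • φ‖ + ‖Q φ - q • φ‖) := by ring

theorem norm_one_sub_le_of_map_map_eq_smul {P Q : E →ₗᵢ[𝕜] E} {φ : E} (hφ : φ ≠ 0) {w : 𝕜}
    (h : P (Q φ) = w • Q (P φ)) :
    ‖1 - w‖ ≤ 2 * (√(1 - (‖inner 𝕜 φ (P φ)‖ / ‖φ‖ ^ 2) ^ 2) +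
      √(1 - (‖inner 𝕜 φ (Q φ)‖ / ‖φ‖ ^ 2) ^ 2)) := by
  have hnorm := norm_one_sub_mul_norm_le (norm_inner_map_div_le_one P φ)
    (norm_inner_map_div_le_one Q φ) h
  rw [norm_map_sub_inner_div_smul, norm_map_sub_inner_div_smul, ← mul_add, mul_left_comm,
    mul_comm] at hnorm
  exact le_of_mul_le_mul_left hnorm (norm_pos_iff.mpr hφ)

end AlmostEigenvectors

section Overlap

variable {ι : Type*} [Fintype ι] [DecidableEq ι]

theorem norm_toEuclideanLin_unitary (U : Matrix.unitaryGroup ι ℂ) (v : EuclideanSpace ℂ ι) :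
    ‖Matrix.toEuclideanLin (U : Matrix ι ι ℂ) v‖ = ‖v‖ := by
  have hU : Matrix.toEuclideanCLM (𝕜 := ℂ) (U : Matrix ι ι ℂ) ∈ unitary _ :=
    Unitary.map_mem _ U.2
  exact ContinuousLinearMap.norm_map_of_mem_unitary hU v

/-- The modulus `|⟨ψ, U ψ⟩| / ⟨ψ, ψ⟩` of the expectation value of `U` in the state `ψ`. -/
noncomputable def overlap (U : Matrix.unitaryGroup ι ℂ) (ψ : ι → ℂ) : ℝ :=
  ‖star ψ ⬝ᵥ (U : Matrix ι ι ℂ) *ᵥ ψ‖ / ‖star ψ ⬝ᵥ ψ‖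

theorem norm_one_sub_le_of_mul_eq_smul {P Q : Matrix.unitaryGroup ι ℂ} {w : ℂ}
    (h : (P * Q : Matrix ι ι ℂ) = w • (Q * P : Matrix ι ι ℂ)) {ψ : ι → ℂ} (hψ : ψ ≠ 0) :
    ‖1 - w‖ ≤ 2 * (√(1 - overlap P ψ ^ 2) + √(1 - overlap Q ψ ^ 2)) := by
  let isometry (U : Matrix.unitaryGroup ι ℂ) : EuclideanSpace ℂ ι →ₗᵢ[ℂ] EuclideanSpace ℂ ι :=
    { toLinearMap := Matrix.toEuclideanLin (U : Matrix ι ι ℂ)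
      norm_map' := norm_toEuclideanLin_unitary U }
  let φ : EuclideanSpace ℂ ι := WithLp.toLp 2 ψ
  have happly (U : Matrix.unitaryGroup ι ℂ) (v : ι → ℂ) :
      isometry U (WithLp.toLp 2 v) = WithLp.toLp 2 ((U : Matrix ι ι ℂ) *ᵥ v) := rfl
  have hinner (v : ι → ℂ) : inner ℂ φ (WithLp.toLp 2 v) = star ψ ⬝ᵥ v := by
    rw [EuclideanSpace.inner_toLp_toLp, dotProduct_comm]
  have hoverlap (U : Matrix.unitaryGroup ι ℂ) :
      overlap U ψ = ‖inner ℂ φ (isometry U φ)‖ / ‖φ‖ ^ 2 := by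
    have hnorm : ‖star ψ ⬝ᵥ ψ‖ = ‖φ‖ ^ 2 := by
      rw [← hinner, inner_self_eq_norm_sq_to_K, norm_pow, RCLike.norm_ofReal, abs_norm]
    rw [overlap, hnorm, happly, hinner]
  rw [hoverlap, hoverlap]
  refine norm_one_sub_le_of_map_map_eq_smul (by simpa [φ] using hψ) ?_
  rw [happly, happly, happly, happly, Matrix.mulVec_mulVec, h, Matrix.smul_mulVec,
    Matrix.mulVec_mulVec, WithLp.toLp_smul]

end Overlap

/-! ### Tensor powers and transfer matrices -/

section Tensor

variable {q : Type*} [Fintype q] [DecidableEq q] {n : ℕ}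

theorem tensorUnitary_apply (U : Fin n → Matrix.unitaryGroup q ℂ) (s t : Fin n → q) :
    (tensorUnitary U : Matrix (Fin n → q) (Fin n → q) ℂ) s t =
      ∏ i, (U i : Matrix q q ℂ) (s i) (t i) := rfl

theorem tensorUnitary_mul (U V : Fin n → Matrix.unitaryGroup q ℂ) :
    tensorUnitary U * tensorUnitary V = tensorUnitary fun i => U i * V i := by
  ext s t
  simp only [Matrix.UnitaryGroup.mul_val, tensorUnitary_apply, Matrix.mul_apply,
    ← Finset.prod_mul_distrib]
  rw [Finset.prod_univ_sum, Fintype.piFinset_univ]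

theorem tensorUnitary_one : tensorUnitary (fun _ : Fin n => (1 : Matrix.unitaryGroup q ℂ)) = 1 := by
  simpa using tensorUnitary_mul (fun _ : Fin n => (1 : Matrix.unitaryGroup q ℂ)) fun _ => 1

theorem tensorUnitary_pow (U : Fin n → Matrix.unitaryGroup q ℂ) (k : ℕ) :
    tensorUnitary U ^ k = tensorUnitary fun i => U i ^ k := by
  induction k with
  | zero => simp only [pow_zero, tensorUnitary_one]
  | succ k ih => simp only [pow_succ, ih, tensorUnitary_mul]

theorem tensorUnitary_eq_prod_smul {U V : Fin n → Matrix.unitaryGroup q ℂ} {z : Fin n → ℂ}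
    (h : ∀ i, (U i : Matrix q q ℂ) = z i • (V i : Matrix q q ℂ)) :
    (tensorUnitary U : Matrix (Fin n → q) (Fin n → q) ℂ) =
      (∏ i, z i) • (tensorUnitary V : Matrix (Fin n → q) (Fin n → q) ℂ) := by
  ext s t
  simp [tensorUnitary_apply, h, Finset.prod_mul_distrib]

theorem tensorUnitary_mul_eq_pow_smul {P Q : Matrix.unitaryGroup q ℂ} {z : ℂ}
    (h : (P * Q : Matrix q q ℂ) = z • (Q * P : Matrix q q ℂ)) (n : ℕ) :
    (tensorUnitary (fun _ : Fin n => P) * tensorUnitary (fun _ : Fin n => Q) :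
      Matrix (Fin n → q) (Fin n → q) ℂ) =
    z ^ n • (tensorUnitary (fun _ : Fin n => Q) * tensorUnitary (fun _ : Fin n => P) :
      Matrix (Fin n → q) (Fin n → q) ℂ) := by
  rw [← Matrix.UnitaryGroup.mul_val, ← Matrix.UnitaryGroup.mul_val, tensorUnitary_mul,
    tensorUnitary_mul,
    tensorUnitary_eq_prod_smul (U := fun _ => P * Q) (V := fun _ => Q * P) fun _ => h,
    Fin.prod_const]

theorem IsInvariantUpToPhase.pow {ι : Type*} [Fintype ι] [DecidableEq ι]
    {U : Matrix.unitaryGroup ι ℂ} {ψ : ι → ℂ} (h : IsInvariantUpToPhase U ψ) (k : ℕ) :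
    IsInvariantUpToPhase (U ^ k) ψ := by
  obtain ⟨z, hz⟩ := h
  refine ⟨z ^ k, ?_⟩
  induction k with
  | zero => simp
  | succ k ih =>
    rw [pow_succ', Matrix.UnitaryGroup.mul_val, ← Matrix.mulVec_mulVec, ih, Matrix.mulVec_smul, hz,
      smul_smul, pow_succ, Circle.coe_mul]

theorem IsInvariantUpToPhase.norm_dotProduct {ι : Type*} [Fintype ι] [DecidableEq ι]
    {U : Matrix.unitaryGroup ι ℂ} {ψ : ι → ℂ} (h : IsInvariantUpToPhase U ψ) :
    ‖star ψ ⬝ᵥ (U : Matrix ι ι ℂ) *ᵥ ψ‖ = ‖star ψ ⬝ᵥ ψ‖ := by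
  obtain ⟨z, hz⟩ := h
  rw [hz, dotProduct_smul, norm_smul, Circle.norm_coe, one_mul]

end Tensor

section Transfer

theorem sum_pow_eq_sum_list_prod {X R : Type*} [Fintype X] [Semiring R] (B : X → R) (n : ℕ) :
    (∑ x, B x) ^ n = ∑ w : Fin n → X, (List.ofFn fun i => B (w i)).prod := by
  induction n with
  | zero => simp
  | succ n ih =>
    rw [pow_succ', ih, ← (Fin.consEquiv fun _ => X).sum_comp, Fintype.sum_prod_type,
      Finset.sum_mul_sum]
    simp [Fin.consEquiv]

theorem list_prod_smul_kronecker {R m p : Type*} [CommSemiring R] [Fintype m] [DecidableEq m]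
    [Fintype p] [DecidableEq p] {n : ℕ} (c : Fin n → R) (B : Fin n → Matrix m m R)
    (C : Fin n → Matrix p p R) :
    (List.ofFn fun i => c i • (B i ⊗ₖ C i)).prod =
      (∏ i, c i) • ((List.ofFn B).prod ⊗ₖ (List.ofFn C).prod) := by
  induction n with
  | zero => simp
  | succ n ih =>
    rw [List.ofFn_succ, List.prod_cons, ih, List.ofFn_succ, List.ofFn_succ, List.prod_cons,
      List.prod_cons, Fin.prod_univ_succ, smul_mul_smul_comm, Matrix.mul_kronecker_mul]

theorem trace_list_prod_map_star {R m : Type*} [CommSemiring R] [StarRing R] [Fintype m]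
    [DecidableEq m] {n : ℕ} (B : Fin n → Matrix m m R) :
    (List.ofFn fun i => (B i).map star).prod.trace = star (List.ofFn B).prod.trace := by
  have hprod : (List.ofFn fun i => (B i).map star).prod =
      (starRingEnd R).mapMatrix (List.ofFn B).prod := by
    rw [map_list_prod, List.map_ofFn]
    rfl
  rw [hprod]
  exact (AddMonoidHom.map_trace (starRingEnd R) _).symm

variable {q : Type*} [Fintype q] {D : ℕ}

/-- The transfer matrix with a one-site operator `U` inserted between the two layers; the traces
of its powers are the expectation values of the operators `U ⊗ ⋯ ⊗ U`. -/
def twistedTransferMatrix (U : Matrix q q ℂ) (A : q → Matrix (Fin D) (Fin D) ℂ) :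
    Matrix (Fin D × Fin D) (Fin D × Fin D) ℂ :=
  ∑ p : q × q, U p.1 p.2 • (A p.2 ⊗ₖ (A p.1).map star)

theorem twistedTransferMatrix_one [DecidableEq q] (A : q → Matrix (Fin D) (Fin D) ℂ) :
    twistedTransferMatrix 1 A = transferMatrix A := by
  simp [twistedTransferMatrix, transferMatrix, Fintype.sum_prod_type, Matrix.one_apply, ite_smul]

theorem trace_twistedTransferMatrix_pow [DecidableEq q] (U : Matrix.unitaryGroup q ℂ)
    (A : q → Matrix (Fin D) (Fin D) ℂ) (n : ℕ) :
    (twistedTransferMatrix (U : Matrix q q ℂ) A ^ n).trace =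
      star (mpsState A n) ⬝ᵥ ((tensorUnitary fun _ : Fin n => U : Matrix.unitaryGroup _ ℂ) :
        Matrix (Fin n → q) (Fin n → q) ℂ) *ᵥ mpsState A n := by
  rw [twistedTransferMatrix, sum_pow_eq_sum_list_prod, Matrix.trace_sum,
    ← (Equiv.arrowProdEquivProdArrow (Fin n) (fun _ => q) fun _ => q).symm.sum_comp,
    Fintype.sum_prod_type]
  simp only [dotProduct, Matrix.mulVec, Finset.mul_sum]
  refine Finset.sum_congr rfl fun s _ => Finset.sum_congr rfl fun t _ => ?_
  simp only [Equiv.arrowProdEquivProdArrow, Equiv.coe_fn_symm_mk]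
  rw [list_prod_smul_kronecker, Matrix.trace_smul, Matrix.trace_kronecker,
    trace_list_prod_map_star, tensorUnitary_apply, smul_eq_mul, Pi.star_apply]
  unfold mpsState
  ring

theorem trace_transferMatrix_pow (A : q → Matrix (Fin D) (Fin D) ℂ) (n : ℕ) :
    (transferMatrix A ^ n).trace = star (mpsState A n) ⬝ᵥ mpsState A n := by
  classical
  have h := trace_twistedTransferMatrix_pow 1 A n
  rwa [tensorUnitary_one, Matrix.UnitaryGroup.one_val, Matrix.UnitaryGroup.one_val,
    Matrix.one_mulVec, twistedTransferMatrix_one] at h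

end Transfer

section InjectiveMPS

open Filter Topology

variable {q : Type*} [Fintype q] {D : ℕ} {A : q → Matrix (Fin D) (Fin D) ℂ}

theorem IsInjectiveMPS.exists_tendsto_norm_trace_pow_div (hA : IsInjectiveMPS A) :
    ∃ r : ℝ, 0 < r ∧
      Tendsto (fun n : ℕ => ‖(transferMatrix A ^ n).trace‖ / r ^ n) atTop (𝓝 1) := by
  obtain ⟨lam, hlam, hsimple, hgap⟩ := hA
  have hpos : 0 < ‖lam‖ := norm_pos_iff.mpr hlam
  exact ⟨‖lam‖, hpos, (hasDominantModulus_roots_charpoly_iff_tendsto _ hpos).mp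
    (hasDominantModulus_roots_of_rootMultiplicity_eq_one hsimple hgap)⟩

variable [DecidableEq q]

theorem IsInjectiveMPS.tendsto_overlap (hA : IsInjectiveMPS A) {L : ℕ} (hL : L ≠ 0)
    {U : Matrix.unitaryGroup q ℂ} (hU : ∀ k : ℕ, 0 < k →
      IsInvariantUpToPhase (tensorUnitary fun _ : Fin (k * L) => U) (mpsState A (k * L))) :
    Tendsto (fun n : ℕ => overlap (tensorUnitary fun _ : Fin n => U) (mpsState A n))
      atTop (𝓝 1) := by
  obtain ⟨r, hr, hlim⟩ := hA.exists_tendsto_norm_trace_pow_div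
  have hcell : Tendsto (fun k : ℕ =>
      ‖(twistedTransferMatrix (U : Matrix q q ℂ) A ^ (k * L)).trace‖ / r ^ (k * L))
      atTop (𝓝 1) := by
    refine (hlim.comp (tendsto_id.atTop_mul_const' (Nat.pos_of_ne_zero hL))).congr' ?_
    filter_upwards [eventually_gt_atTop 0] with k hk
    rw [trace_twistedTransferMatrix_pow, (hU k hk).norm_dotProduct, ← trace_transferMatrix_pow]
    rfl
  have hratio := (tendsto_norm_trace_pow_div_of_tendsto_mul _ hr hL hcell).div hlim one_ne_zero
  rw [div_one] at hratio
  refine hratio.congr fun n => ?_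
  rw [Pi.div_apply, div_div_div_cancel_right₀ (pow_pos hr n).ne', overlap,
    trace_twistedTransferMatrix_pow, trace_transferMatrix_pow]

theorem eq_one_of_tendsto_pow {𝕜 : Type*} [RCLike 𝕜] {z : 𝕜}
    (h : Tendsto (fun n : ℕ => z ^ n) atTop (𝓝 1)) : z = 1 := by
  have hsucc : Tendsto (fun n : ℕ => z ^ (n + 1)) atTop (𝓝 1) := h.comp (tendsto_add_atTop_nat 1)
  have hmul : Tendsto (fun n : ℕ => z ^ (n + 1)) atTop (𝓝 z) := by
    simpa only [pow_succ', mul_one] using h.const_mul z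
  exact tendsto_nhds_unique hmul hsucc

/-- On `n` sites the two symmetries commute up to `z ^ n`, while the overlaps force this phase to
tend to `1`, also along the lengths that are not multiples of `L`. -/
theorem IsInjectiveMPS.eq_one_of_isInvariantUpToPhase (hA : IsInjectiveMPS A) {L : ℕ} (hL : L ≠ 0)
    {P Q : Matrix.unitaryGroup q ℂ} {z : ℂ}
    (hPQ : (P * Q : Matrix q q ℂ) = z • (Q * P : Matrix q q ℂ))
    (hP : ∀ k : ℕ, 0 < k →
      IsInvariantUpToPhase (tensorUnitary fun _ : Fin (k * L) => P) (mpsState A (k * L)))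
    (hQ : ∀ k : ℕ, 0 < k →
      IsInvariantUpToPhase (tensorUnitary fun _ : Fin (k * L) => Q) (mpsState A (k * L))) :
    z = 1 := by
  have hoverlapP := hA.tendsto_overlap hL hP
  have hoverlapQ := hA.tendsto_overlap hL hQ
  have hdefect {x : ℕ → ℝ} (hx : Tendsto x atTop (𝓝 1)) :
      Tendsto (fun n => √(1 - x n ^ 2)) atTop (𝓝 0) := by
    simpa using ((hx.pow 2).const_sub 1).sqrt
  have hbound := ((hdefect hoverlapP).add (hdefect hoverlapQ)).const_mul 2
  rw [add_zero, mul_zero] at hbound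
  refine eq_one_of_tendsto_pow (tendsto_iff_norm_sub_tendsto_zero.mpr
    (squeeze_zero' (.of_forall fun _ => norm_nonneg _) ?_ hbound))
  filter_upwards [hoverlapP.eventually_ne one_ne_zero] with n hn
  rw [norm_sub_rev]
  refine norm_one_sub_le_of_mul_eq_smul (tensorUnitary_mul_eq_pow_smul hPQ n) fun hψ => hn ?_
  simp [overlap, hψ]

end InjectiveMPS

/-! ### Factor systems and commutator phases -/

section FactorSystem

variable {q : Type*} [Fintype q] [DecidableEq q]

theorem smul_unitary_injective [Nonempty q] (U : Matrix.unitaryGroup q ℂ) :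
    Function.Injective fun z : ℂ => z • (U : Matrix q q ℂ) := by
  intro z w h
  have h1 : z • (1 : Matrix q q ℂ) = w • 1 := by
    simpa only [Matrix.smul_mul, Matrix.mem_unitaryGroup_iff.mp U.2] using
      congrArg (· * star (U : Matrix q q ℂ)) h
  simpa using congrFun (congrFun h1 (Classical.arbitrary q)) (Classical.arbitrary q)

variable {G : Type*} [Group G] {U : G → Matrix.unitaryGroup q ℂ} {ν ν' : G × G → Circle}

theorem isCocycle_iff {ω : G × G → Circle} :
    IsCocycle ω ↔ ∀ g h k : G, ω (g * h, k) * ω (g, h) = ω (h, k) * ω (g, h * k) := Iff.rfl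

theorem cohomologous_iff {ω ω' : G × G → Circle} :
    Cohomologous ω ω' ↔ ∃ f : G → Circle, ∀ g h : G,
      f h / f (g * h) * f g = ω (g, h) / ω' (g, h) := Iff.rfl

theorem IsFactorSystem.isCocycle [Nonempty q] (hU : IsFactorSystem U ν) : IsCocycle ν := by
  refine isCocycle_iff.mpr fun g h k => Circle.ext (smul_unitary_injective (U (g * h * k)) ?_)
  have left_assoc : (U g : Matrix q q ℂ) * U h * U k =
      ((ν (g * h, k) * ν (g, h) : Circle) : ℂ) • (U (g * h * k) : Matrix q q ℂ) := by
    rw [hU g h, Matrix.smul_mul, hU, smul_smul, Circle.coe_mul, mul_comm]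
  have right_assoc : (U g : Matrix q q ℂ) * (U h * U k) =
      ((ν (h, k) * ν (g, h * k) : Circle) : ℂ) • (U (g * h * k) : Matrix q q ℂ) := by
    rw [hU h k, Matrix.mul_smul, hU, smul_smul, Circle.coe_mul, mul_assoc]
  exact left_assoc.symm.trans ((mul_assoc _ _ _).trans right_assoc)

theorem IsFactorSystem.unique [Nonempty q] (h : IsFactorSystem U ν) (h' : IsFactorSystem U ν') :
    ν = ν' := by
  ext ⟨g, k⟩
  exact smul_unitary_injective (U (g * k)) ((h g k).symm.trans (h' g k))

theorem IsFactorSystem.tensorUnitary {n : ℕ} {U : Fin n → G → Matrix.unitaryGroup q ℂ}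
    {ν : Fin n → G × G → Circle} (h : ∀ i, IsFactorSystem (U i) (ν i)) :
    IsFactorSystem (fun g => DihedralLSM.tensorUnitary fun i => U i g) (∏ i, ν i) := by
  intro g k
  rw [← Matrix.UnitaryGroup.mul_val, tensorUnitary_mul,
    tensorUnitary_eq_prod_smul (U := fun i => U i g * U i k) fun i => h i g k, Finset.prod_apply]
  exact congrArg (· • _) (map_prod Circle.coeHom _ _).symm

/-- The homomorphism to the unitary group modulo phases that a projective representation
determines. -/
def IsFactorSystem.projectiveHom (h : IsFactorSystem U ν) :
    G →* Matrix.unitaryGroup q ℂ ⧸ phases q :=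
  MonoidHom.mk' (fun g => (U g : Matrix.unitaryGroup q ℂ ⧸ phases q)) fun g k => by
    rw [← QuotientGroup.mk_mul]
    refine QuotientGroup.eq.mpr ⟨ν (g, k), ?_⟩
    rw [Matrix.UnitaryGroup.mul_val, Matrix.UnitaryGroup.mul_val, h, Matrix.mul_smul,
      ← Matrix.UnitaryGroup.mul_val, inv_mul_cancel, Matrix.UnitaryGroup.one_val]

/-- A projective representation with trivial factor system, as a homomorphism. -/
def IsFactorSystem.linearHom (h : IsFactorSystem U 1) : G →* Matrix.unitaryGroup q ℂ :=
  MonoidHom.mk' U fun g k => Subtype.ext <| by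
    rw [Matrix.UnitaryGroup.mul_val, h, Pi.one_apply, Circle.coe_one, one_smul]

end FactorSystem

section CommutatorPhase

variable {G : Type*}

/-- The commutator phase of a 2-cochain, that is, the phase by which the operators of `g` and `h`
commute in a projective representation with this factor system. It is an invariant of the
cohomology class only if `g` and `h` commute. -/
noncomputable def commutatorPhase (ω : G × G → Circle) (g h : G) : Circle := ω (g, h) / ω (h, g)

variable {ω ω' ν : G × G → Circle} {g g' h : G}

theorem commutatorPhase_one : commutatorPhase (1 : G × G → Circle) g h = 1 := div_one _

theorem commutatorPhase_mul :
    commutatorPhase (ω * ω') g h = commutatorPhase ω g h * commutatorPhase ω' g h :=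
  mul_div_mul_comm _ _ _ _

theorem commutatorPhase_pullback (T : G → G) :
    commutatorPhase (pullback T ω) g h = commutatorPhase ω (T g) (T h) := rfl

variable [Group G]

theorem Cohomologous.commutatorPhase_eq (hω : Cohomologous ω ω') (hgh : Commute g h) :
    commutatorPhase ω g h = commutatorPhase ω' g h := by
  obtain ⟨f, hf⟩ := cohomologous_iff.mp hω
  rw [commutatorPhase, commutatorPhase, div_eq_div_iff_div_eq_div, ← hf g h, ← hf h g, hgh.eq,
    div_mul_eq_mul_div, div_mul_eq_mul_div, mul_comm]

theorem not_isCoboundary_of_commutatorPhase_ne_one (hgh : Commute g h)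
    (hω : commutatorPhase ω g h ≠ 1) : ¬ IsCoboundary ω := by
  intro h_cob
  have h_one : Cohomologous ω 1 := by rwa [Cohomologous, div_one]
  exact hω ((h_one.commutatorPhase_eq hgh).trans commutatorPhase_one)

theorem not_cohomologous_pullback_of_commutatorPhase_ne_one {T : G → G} (hgh : Commute g h)
    (hg : T g = g) (hh : T h = h) (hν : commutatorPhase ν g h ≠ 1)
    (hω : Cohomologous ω' (ν * ω)) : ¬ Cohomologous ω' (pullback T ω) := by
  intro hT
  have h_eq : commutatorPhase ν g h * commutatorPhase ω g h = commutatorPhase ω g h := by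
    rw [← commutatorPhase_mul, ← hω.commutatorPhase_eq hgh, hT.commutatorPhase_eq hgh,
      commutatorPhase_pullback, hg, hh]
  exact hν (mul_eq_right.mp h_eq)

theorem IsCocycle.commutatorPhase_mul_left (hω : IsCocycle ω) (hg : Commute g h)
    (hg' : Commute g' h) :
    commutatorPhase ω (g * g') h = commutatorPhase ω g h * commutatorPhase ω g' h := by
  have h₁ := isCocycle_iff.mp hω g g' h
  have h₂ := isCocycle_iff.mp hω g h g'
  have h₃ := isCocycle_iff.mp hω h g g'
  rw [← hg.eq] at h₃
  rw [← hg'.eq] at h₂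
  simp only [commutatorPhase]
  rw [div_mul_div_comm, div_eq_div_iff_mul_eq_mul]
  apply mul_left_cancel (a := ω (g, g') * (ω (g * h, g') * ω (g, g' * h)))
  calc _ = (ω (g * g', h) * ω (g, g')) * (ω (g * h, g') * ω (h, g)) *
        (ω (h, g') * ω (g, g' * h)) := by ac_rfl
    _ = _ := by rw [h₁, h₃, ← h₂]; ac_rfl

theorem IsCocycle.commutatorPhase_one_left (hω : IsCocycle ω) : commutatorPhase ω 1 h = 1 := by
  simpa using hω.commutatorPhase_mul_left (Commute.one_left h) (Commute.one_left h)

theorem IsCocycle.commutatorPhase_sq (hω : IsCocycle ω) (hgh : Commute g h) (hg : g * g = 1) :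
    commutatorPhase ω g h ^ 2 = 1 := by
  rw [sq, ← hω.commutatorPhase_mul_left hgh hgh, hg, hω.commutatorPhase_one_left]

theorem IsFactorSystem.mul_eq_commutatorPhase_smul {q : Type*} [Fintype q] [DecidableEq q]
    {U : G → Matrix.unitaryGroup q ℂ} (hU : IsFactorSystem U ω) (hgh : Commute g h) :
    (U g * U h : Matrix q q ℂ) = (commutatorPhase ω g h : ℂ) • (U h * U g : Matrix q q ℂ) := by
  rw [hU g h, hU h g, smul_smul, ← Circle.coe_mul, commutatorPhase, div_mul_cancel, hgh.eq]

end CommutatorPhase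

/-! ### One-site operators of the dihedral group -/

section SiteOp

variable (N : ℕ) [NeZero N]

theorem shift_zpow_apply (k : ℤ) (s t : ZMod N) :
    (shift N ^ k : Matrix.unitaryGroup (ZMod N) ℂ) s t = if s = t + k then 1 else 0 := by
  induction k generalizing s t with
  | zero => simp [Matrix.one_apply]
  | succ k ih =>
    rw [zpow_add_one, Matrix.UnitaryGroup.mul_val, Matrix.mul_apply]
    simp only [ih]
    simp [shift, add_comm, add_left_comm]
  | pred k ih =>
    rw [zpow_sub_one, Matrix.UnitaryGroup.mul_val, Matrix.mul_apply]
    have h (x : ZMod N) : t = x + 1 ↔ x = t - 1 := by rw [eq_sub_iff_add_eq, eq_comm]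
    simp only [ih, Matrix.UnitaryGroup.inv_val, Matrix.star_apply]
    simp only [shift, Matrix.of_apply, h, apply_ite star, star_one, star_zero, mul_ite, mul_one,
      mul_zero, Finset.sum_ite_eq', Finset.mem_univ, if_true]
    congr 2
    push_cast
    ring

variable {N} in
theorem shift_zpow_congr {k l : ℤ} (h : (k : ZMod N) = l) : shift N ^ k = shift N ^ l := by
  ext s t
  rw [shift_zpow_apply, shift_zpow_apply, h]

theorem chargeConj_mul_clock_apply (s t : ZMod N) :
    (chargeConj N * clock N : Matrix.unitaryGroup (ZMod N) ℂ) s t =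
      if s = -t then (ZMod.toCircle t : ℂ) else 0 := by
  simp [chargeConj, clock]

variable (a : ℤ) (j : ℕ)

theorem siteOp_r_apply (i s t : ZMod N) :
    siteOp N a j (.r i) s t = if s = t + a ^ j * i then 1 else 0 := by
  simp [siteOp, shift_zpow_apply]

theorem siteOp_sr_apply (i s t : ZMod N) :
    siteOp N a j (.sr i) s t =
      if s = -(t + a ^ j * i) then (ZMod.toCircle (t + (a : ZMod N) ^ j * i) : ℂ) else 0 := by
  rw [siteOp, Matrix.UnitaryGroup.mul_val, Matrix.mul_apply]
  simp only [shift_zpow_apply, chargeConj_mul_clock_apply]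
  simp

/-- The exponent `i` of the rotation in the normal forms `x ^ i` and `c x ^ i` of the elements of
the dihedral group. -/
def rotationExponent : DihedralGroup N → ZMod N
  | .r i => i
  | .sr i => i

/-- The factor system of the one-site operators: only moving `C Z` to the left past a power of `X`
costs a phase. -/
noncomputable def siteCocycle : DihedralGroup N × DihedralGroup N → Circle
  | (_, .r _) => 1
  | (g, .sr _) => ZMod.toCircle ((a : ZMod N) ^ j * rotationExponent N g)

theorem isFactorSystem_siteCocycle : IsFactorSystem (siteOp N a j) (siteCocycle N a j) := by
  rintro (i | i) (k | k) <;> ext s t <;>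
    simp only [Matrix.mul_apply, Matrix.smul_apply, siteOp_r_apply, siteOp_sr_apply,
      DihedralGroup.r_mul_r, DihedralGroup.r_mul_sr, DihedralGroup.sr_mul_r,
      DihedralGroup.sr_mul_sr, siteCocycle, rotationExponent, mul_ite, mul_zero, ite_mul,
      zero_mul, Finset.sum_ite_eq', Finset.mem_univ, if_true, smul_eq_mul, mul_one, one_mul,
      Circle.coe_one, ← Circle.coe_mul, ← AddChar.map_add_eq_mul] <;>
    ring_nf

variable {N a j}

theorem siteOp_succ (g : DihedralGroup N) :
    siteOp N a (j + 1) g = siteOp N a j (translation N a g) := by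
  have h_rot (i : ZMod N) : shift N ^ (a ^ (j + 1) * (i.val : ℤ)) =
      shift N ^ (a ^ j * (((a : ZMod N) * i).val : ℤ)) :=
    shift_zpow_congr (by simp [pow_succ, mul_assoc])
  rcases g with i | i
  · exact h_rot i
  · exact congrArg (chargeConj N * clock N * ·) (h_rot i)

theorem translation_bijective (ha : IsCoprime a (N : ℤ)) :
    Function.Bijective (translation N a) := by
  rw [← Finite.injective_iff_bijective]
  have h_unit : IsUnit (a : ZMod N) := (ZMod.coe_int_isUnit_iff_isCoprime a N).mpr ha.symm
  rintro (i | i) (k | k) h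
  · exact congrArg _ (h_unit.mul_left_cancel (DihedralGroup.r.inj h))
  · cases h
  · cases h
  · exact congrArg _ (h_unit.mul_left_cancel (DihedralGroup.sr.inj h))

end SiteOp

section HalfTurn

variable {N : ℕ}

variable (N) in
/-- The rotation `x ^ (N / 2)`, for even `N` the central rotation of order two. -/
def halfTurn : DihedralGroup N := .r ((N / 2 : ℕ) : ZMod N)

theorem half_add_half (hN : Even N) : ((N / 2 : ℕ) : ZMod N) + ((N / 2 : ℕ) : ZMod N) = 0 := by
  rw [← Nat.cast_add, ← two_mul, Nat.mul_div_cancel' hN.two_dvd, ZMod.natCast_self]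

theorem odd_mul_half (hN : Even N) {a : ℤ} (ha : Odd a) :
    (a : ZMod N) * ((N / 2 : ℕ) : ZMod N) = ((N / 2 : ℕ) : ZMod N) := by
  obtain ⟨b, rfl⟩ := ha
  push_cast
  linear_combination (b : ZMod N) * half_add_half hN

theorem toCircle_half [NeZero N] (hN : Even N) :
    (ZMod.toCircle ((N / 2 : ℕ) : ZMod N) : ℂ) = -1 := by
  obtain ⟨k, rfl⟩ := hN
  have hk : (k : ℂ) ≠ 0 := by
    have := NeZero.ne (k + k)
    exact_mod_cast fun h => this (by omega)
  rw [ZMod.toCircle_natCast, ← Complex.exp_pi_mul_I, ← two_mul, Nat.mul_div_cancel_left _ two_pos]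
  congr 1
  push_cast
  field_simp

theorem halfTurn_mul_self (hN : Even N) : halfTurn N * halfTurn N = 1 := by
  rw [halfTurn, DihedralGroup.r_mul_r, half_add_half hN, DihedralGroup.r_zero]

theorem commute_halfTurn_sr_zero (hN : Even N) : Commute (halfTurn N) (.sr 0) := by
  rw [Commute, SemiconjBy, halfTurn, DihedralGroup.r_mul_sr, DihedralGroup.sr_mul_r, zero_add,
    zero_sub, neg_eq_of_add_eq_zero_left (half_add_half hN)]

theorem translation_halfTurn (hN : Even N) {a : ℤ} (ha : Odd a) :
    translation N a (halfTurn N) = halfTurn N :=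
  congrArg DihedralGroup.r (odd_mul_half hN ha)

theorem translation_sr_zero (a : ℤ) : translation N a (.sr 0) = .sr 0 :=
  congrArg DihedralGroup.sr (mul_zero _)

variable {ω ω' ν : DihedralGroup N × DihedralGroup N → Circle}

theorem halfTurnPhase_eq_commutatorPhase :
    halfTurnPhase ω = commutatorPhase ω (halfTurn N) (.sr 0) := rfl

theorem commutatorPhase_halfTurn_ne_one (hω : halfTurnPhase ω = -1) :
    commutatorPhase ω (halfTurn N) (.sr 0) ≠ 1 := by
  intro h
  rw [halfTurnPhase_eq_commutatorPhase, h] at hω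
  norm_num at hω

theorem Cohomologous.halfTurnPhase_eq (hN : Even N) (h : Cohomologous ω ω') :
    halfTurnPhase ω = halfTurnPhase ω' :=
  congrArg Circle.coeHom (h.commutatorPhase_eq (commute_halfTurn_sr_zero hN))

theorem not_isCoboundary_of_halfTurnPhase_eq_neg_one (hN : Even N) (hω : halfTurnPhase ω = -1) :
    ¬ IsCoboundary ω :=
  not_isCoboundary_of_commutatorPhase_ne_one (commute_halfTurn_sr_zero hN)
    (commutatorPhase_halfTurn_ne_one hω)

theorem IsCocycle.exists_halfTurnPhase_eq_neg_one_zpow (hN : Even N) (hω : IsCocycle ω) :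
    ∃ m : ℤ, (m = 0 ∨ m = 1) ∧ halfTurnPhase ω = (-1) ^ m := by
  have h_sq : halfTurnPhase ω ^ 2 = 1 := by
    rw [halfTurnPhase_eq_commutatorPhase, ← Circle.coe_pow,
      hω.commutatorPhase_sq (commute_halfTurn_sr_zero hN) (halfTurn_mul_self hN), Circle.coe_one]
  rcases sq_eq_one_iff.mp h_sq with h | h
  · exact ⟨0, Or.inl rfl, by rw [h, zpow_zero]⟩
  · exact ⟨1, Or.inr rfl, by rw [h, zpow_one]⟩

variable {a : ℤ}

theorem halfTurnPhase_eq_neg_one_of_isFactorSystem_siteOp [NeZero N] (hN : Even N) (ha : Odd a)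
    {j : ℕ} (hν : IsFactorSystem (siteOp N a j) ν) : halfTurnPhase ν = -1 := by
  rw [hν.unique (isFactorSystem_siteCocycle N a j)]
  simp only [halfTurnPhase, siteCocycle, rotationExponent, div_one]
  rw [← Int.cast_pow, odd_mul_half hN ha.pow, toCircle_half hN]

theorem halfTurnPhase_pullback_iterate (hN : Even N) (ha : Odd a) (j : ℕ) :
    halfTurnPhase (pullback (translation N a)^[j] ω) = halfTurnPhase ω := by
  simp only [halfTurnPhase_eq_commutatorPhase, commutatorPhase_pullback,
    Function.iterate_fixed (translation_halfTurn hN ha) j,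
    Function.iterate_fixed (translation_sr_zero a) j]

theorem halfTurnPhase_pullback_iterate_eq_neg_one_zpow (hN : Even N) (ha : Odd a) {m : ℤ}
    (hm : halfTurnPhase ω = (-1) ^ m) (j : ℕ) :
    halfTurnPhase (pullback (translation N a)^[j] ω) = (-1) ^ (m * a ^ j) := by
  rw [halfTurnPhase_pullback_iterate hN ha, hm, zpow_mul']
  exact congrArg (· ^ m) ha.pow.neg_one_zpow.symm

theorem neg_one_zpow_eq_neg_one_zpow_iff {m n : ℤ} :
    (-1 : ℂ) ^ m = (-1) ^ n ↔ m ≡ n [ZMOD 2] := by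
  have h_ne : (-1 : ℂ) ≠ 1 := by norm_num
  rcases Int.even_or_odd m with hm | hm <;> rcases Int.even_or_odd n with hn | hn <;>
    simp [hm.neg_one_zpow, hn.neg_one_zpow, Int.ModEq, Int.even_iff.mp, Int.odd_iff.mp, hm, hn,
      h_ne, h_ne.symm]

theorem halfTurnPhase_pullback_succ_eq_iff [NeZero N] (hN : Even N) (ha : Odd a) {m : ℤ}
    (hm : halfTurnPhase ω = (-1) ^ m) {j : ℕ} (hν : IsFactorSystem (siteOp N a j) ν) :
    halfTurnPhase (pullback (translation N a)^[j + 1] ω) =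
        halfTurnPhase (ν * pullback (translation N a)^[j] ω) ↔
      m * (a - 1) ≡ 1 [ZMOD 2] := by
  have h_left := halfTurnPhase_pullback_iterate_eq_neg_one_zpow hN ha hm (j + 1)
  have h_right : halfTurnPhase (ν * pullback (translation N a)^[j] ω) = (-1) ^ (1 + m * a ^ j) := by
    rw [halfTurnPhase_eq_commutatorPhase, commutatorPhase_mul, Circle.coe_mul,
      ← halfTurnPhase_eq_commutatorPhase, ← halfTurnPhase_eq_commutatorPhase,
      halfTurnPhase_eq_neg_one_of_isFactorSystem_siteOp hN ha hν,
      halfTurnPhase_pullback_iterate_eq_neg_one_zpow hN ha hm, zpow_add₀ (by simp), zpow_one]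
  have h_pow : a ^ j ≡ 1 [ZMOD 2] := Int.odd_iff.mp ha.pow
  have h_left_mod : m * a ^ (j + 1) ≡ m * a [ZMOD 2] := by
    simpa only [pow_succ', mul_one, mul_assoc] using h_pow.mul_left (m * a)
  have h_right_mod : 1 + m * a ^ j ≡ 1 + m [ZMOD 2] := by
    simpa only [mul_one] using (h_pow.mul_left m).add_left 1
  rw [h_left, h_right, neg_one_zpow_eq_neg_one_zpow_iff, Int.ModEq, h_left_mod, h_right_mod,
    mul_sub_one, Int.ModEq]
  omega

theorem not_cohomologous_pullback_translation [NeZero N] (hN : Even N) (ha : Odd a) {j : ℕ}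
    (hν : IsFactorSystem (siteOp N a j) ν) (hω : Cohomologous ω' (ν * ω)) :
    ¬ Cohomologous ω' (pullback (translation N a) ω) :=
  not_cohomologous_pullback_of_commutatorPhase_ne_one (commute_halfTurn_sr_zero hN)
    (translation_halfTurn hN ha) (translation_sr_zero a)
    (commutatorPhase_halfTurn_ne_one (halfTurnPhase_eq_neg_one_of_isFactorSystem_siteOp hN ha hν))
    hω

theorem odd_of_isCoprime_of_even (hN : Even N) (ha : IsCoprime a (N : ℤ)) : Odd a := by
  rw [← Int.isCoprime_two_right]
  exact ha.of_isCoprime_of_dvd_right (by exact_mod_cast hN.two_dvd)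

theorem not_mul_sub_one_modEq_one (ha : Odd a) (m : ℤ) : ¬ m * (a - 1) ≡ 1 [ZMOD 2] := by
  intro h
  have h_odd : Odd (m * (a - 1)) := Int.odd_iff.mpr h
  exact Int.not_odd_iff_even.mpr ((ha.sub_odd odd_one).mul_left m) h_odd

end HalfTurn

/-! ### The unit cell and the chain -/

section Phases

variable {q : Type*} [Fintype q] [DecidableEq q] [Nonempty q]

theorem mem_phases_of_eq_smul_one {U : Matrix.unitaryGroup q ℂ} {z : ℂ}
    (hU : (U : Matrix q q ℂ) = z • 1) : U ∈ phases q := by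
  have h_star : star z * z = 1 := by
    have h := Matrix.mem_unitaryGroup_iff'.mp U.2
    rw [hU, star_smul, star_one, smul_mul_smul_comm, one_mul] at h
    exact smul_unitary_injective 1 (h.trans (one_smul ℂ _).symm)
  have h_norm : ‖z‖ ^ 2 = 1 := by exact_mod_cast (Complex.conj_mul' z).symm.trans h_star
  exact ⟨⟨z, mem_sphere_zero_iff_norm.mpr ((pow_eq_one_iff_of_nonneg (norm_nonneg z)
    two_ne_zero).mp h_norm)⟩, hU⟩

theorem mem_phases_of_tensorUnitary_mem_phases {n : ℕ} {U : Fin n → Matrix.unitaryGroup q ℂ}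
    (hU : tensorUnitary U ∈ phases (Fin n → q)) (i : Fin n) : U i ∈ phases q := by
  obtain ⟨z, hz⟩ := hU
  have h_entry (s t : Fin n → q) :
      ∏ j, (U j : Matrix q q ℂ) (s j) (t j) = if s = t then (z : ℂ) else 0 := by
    rw [← tensorUnitary_apply, hz, Matrix.smul_apply, Matrix.one_apply, smul_eq_mul, mul_ite,
      mul_one, mul_zero]
  let o : Fin n → q := fun _ => Classical.arbitrary q
  set w := ∏ j ∈ Finset.univ.erase i, (U j : Matrix q q ℂ) (o j) (o j)
  have h_split (s t : q) : (U i : Matrix q q ℂ) s t * w = if s = t then (z : ℂ) else 0 := by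
    have h := h_entry (Function.update o i s) (Function.update o i t)
    have h_erase : ∏ j ∈ Finset.univ.erase i, (U j : Matrix q q ℂ) (Function.update o i s j)
        (Function.update o i t j) = w := Finset.prod_congr rfl fun j hj => by
      rw [Function.update_of_ne (Finset.ne_of_mem_erase hj),
        Function.update_of_ne (Finset.ne_of_mem_erase hj)]
    rw [← Finset.mul_prod_erase _ _ (Finset.mem_univ i), h_erase, Function.update_self,
      Function.update_self] at h
    simpa only [(Function.update_injective o i).eq_iff] using h
  have hw : w ≠ 0 := by
    rintro hw
    have h := h_split (o i) (o i)
    rw [hw, mul_zero, if_pos rfl] at h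
    exact z.coe_ne_zero h.symm
  refine mem_phases_of_eq_smul_one (z := z / w) ?_
  ext s t
  rw [eq_div_of_mul_eq hw (h_split s t), Matrix.smul_apply, Matrix.one_apply]
  split_ifs <;> simp

end Phases

section Dihedral

variable {N : ℕ} [NeZero N] {H : Type*} [Group H]

theorem closure_r_one_sr_zero : Subgroup.closure {(.r 1 : DihedralGroup N), .sr 0} = ⊤ := by
  set K := Subgroup.closure {(.r 1 : DihedralGroup N), .sr 0}
  have hr (i : ZMod N) : DihedralGroup.r i ∈ K := by
    have h := Subgroup.pow_mem _ (Subgroup.subset_closure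
      (Set.mem_insert (.r 1 : DihedralGroup N) {.sr 0})) i.val
    rwa [DihedralGroup.r_one_pow, ZMod.natCast_zmod_val] at h
  have hs : (.sr 0 : DihedralGroup N) ∈ K := Subgroup.subset_closure (by simp)
  rw [Subgroup.eq_top_iff']
  rintro (i | i)
  · exact hr i
  · simpa only [DihedralGroup.sr_mul_r, zero_add] using mul_mem hs (hr i)

theorem exists_mulEquiv_closure_of_injective {f : DihedralGroup N →* H}
    (hf : Function.Injective f) {K : Subgroup H}
    (hK : K = Subgroup.closure {f (.r 1), f (.sr 0)}) :
    ∃ e : DihedralGroup N ≃* K, (e (.r 1) : H) = f (.r 1) ∧ (e (.sr 0) : H) = f (.sr 0) := by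
  rw [← Set.image_pair, ← MonoidHom.map_closure, closure_r_one_sr_zero,
    ← MonoidHom.range_eq_map] at hK
  subst hK
  exact ⟨MonoidHom.ofInjective hf, rfl, rfl⟩

end Dihedral

section Chain

variable {N : ℕ} [NeZero N] {a : ℤ} {L : ℕ}

theorem eq_one_of_siteOp_zero_mem_phases (hN : 1 < N) {g : DihedralGroup N}
    (hg : siteOp N a 0 g ∈ phases (ZMod N)) : g = 1 := by
  have : Fact (1 < N) := ⟨hN⟩
  obtain ⟨z, hz⟩ := hg
  have h_diag (s : ZMod N) : siteOp N a 0 g s s = z := by simp [hz]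
  rcases g with k | k
  · have hk := h_diag 0
    rw [siteOp_r_apply, pow_zero, one_mul, zero_add] at hk
    by_cases h : 0 = k
    · rw [← h, DihedralGroup.r_zero]
    · exact absurd ((if_neg h).symm.trans hk).symm z.coe_ne_zero
  · exfalso
    have h_refl (s : ZMod N) : s = -(s + k) ∧ ZMod.toCircle (s + k) = z := by
      have h := h_diag s
      rw [siteOp_sr_apply, pow_zero, one_mul] at h
      split_ifs at h with hs
      · exact ⟨hs, Circle.ext h⟩
      · exact absurd h.symm z.coe_ne_zero
    have h01 := ZMod.injective_toCircle ((h_refl 0).2.trans (h_refl 1).2.symm)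
    exact zero_ne_one (add_right_cancel h01)

variable (N a L)

/-- The projective action of the dihedral group on a unit cell of `L` sites. -/
noncomputable def cellOp (g : DihedralGroup N) : Matrix.unitaryGroup (Fin L → ZMod N) ℂ :=
  tensorUnitary fun i => siteOp N a i g

/-- The factor system of the action on a unit cell. -/
noncomputable def cellCocycle : DihedralGroup N × DihedralGroup N → Circle :=
  ∏ i : Fin L, siteCocycle N a i

theorem isFactorSystem_cellOp : IsFactorSystem (cellOp N a L) (cellCocycle N a L) :=
  IsFactorSystem.tensorUnitary fun i : Fin L => isFactorSystem_siteCocycle N a i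

variable {N}

theorem cellCocycle_r (g : DihedralGroup N) (k : ZMod N) : cellCocycle N a L (g, .r k) = 1 := by
  simp [cellCocycle, siteCocycle]

theorem cellCocycle_sr (g : DihedralGroup N) (k : ZMod N) :
    cellCocycle N a L (g, .sr k) =
      ZMod.toCircle (((∑ j ∈ Finset.range L, a ^ j : ℤ) : ZMod N) * rotationExponent N g) := by
  have h_sum (f : Fin L → ZMod N) : ZMod.toCircle (∑ i, f i) = ∏ i, ZMod.toCircle (f i) :=
    map_prod (ZMod.toCircle (N := N)).toMonoidHom (fun i => Multiplicative.ofAdd (f i)) Finset.univ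
  rw [← Fin.sum_univ_eq_sum_range, Int.cast_sum, Finset.sum_mul, h_sum]
  simp [cellCocycle, siteCocycle]

theorem cellCocycle_r_one_sr_zero_eq_one_iff :
    cellCocycle N a L (.r 1, .sr 0) = 1 ↔ (N : ℤ) ∣ ∑ j ∈ Finset.range L, a ^ j := by
  rw [← ZMod.intCast_zmod_eq_zero_iff_dvd, cellCocycle_sr, rotationExponent, mul_one,
    ← ZMod.injective_toCircle.eq_iff, AddChar.map_zero_eq_one]

variable {a L} in
theorem cellCocycle_eq_one (h : (N : ℤ) ∣ ∑ j ∈ Finset.range L, a ^ j) :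
    cellCocycle N a L = 1 := by
  rw [← ZMod.intCast_zmod_eq_zero_iff_dvd] at h
  ext ⟨g, k | k⟩
  · rw [cellCocycle_r, Pi.one_apply]
  · rw [cellCocycle_sr, h, zero_mul, AddChar.map_zero_eq_one, Pi.one_apply]

variable (N)

theorem cellOp_r_one : cellOp N a L (.r 1) = symX N a L L := by
  refine congrArg tensorUnitary (funext fun i => shift_zpow_congr ?_)
  rw [Nat.mod_eq_of_lt i.2, Int.cast_mul, Int.cast_natCast, ZMod.natCast_zmod_val, mul_one]

theorem cellOp_sr_zero : cellOp N a L (.sr 0) = symC N L := by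
  simp [cellOp, symC, siteOp]

variable {N a L}

theorem eq_one_of_cellOp_mem_phases (hN : 1 < N) (hL : 0 < L) {g : DihedralGroup N}
    (hg : cellOp N a L g ∈ phases (Fin L → ZMod N)) : g = 1 :=
  eq_one_of_siteOp_zero_mem_phases hN (mem_phases_of_tensorUnitary_mem_phases hg ⟨0, hL⟩)

theorem exists_mulEquiv_modulo_phases (hN : 1 < N) (hL : 0 < L) :
    ∃ e : DihedralGroup N ≃* (Subgroup.closure {symX N a L L, symC N L}).map
        (QuotientGroup.mk' (phases (Fin L → ZMod N))),
      (e (.r 1) : _ ⧸ phases (Fin L → ZMod N)) = symX N a L L ∧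
      (e (.sr 0) : _ ⧸ phases (Fin L → ZMod N)) = symC N L := by
  let f := (isFactorSystem_cellOp N a L).projectiveHom
  have hf : Function.Injective f := (injective_iff_map_eq_one f).mpr fun g hg =>
    eq_one_of_cellOp_mem_phases hN hL ((QuotientGroup.eq_one_iff _).mp hg)
  rw [← cellOp_r_one, ← cellOp_sr_zero]
  refine exists_mulEquiv_closure_of_injective hf ?_
  rw [MonoidHom.map_closure, Set.image_pair]
  rfl

theorem symX_mul_symC_mul_symX :
    (symX N a L L * symC N L * symX N a L L : Matrix (Fin L → ZMod N) (Fin L → ZMod N) ℂ) =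
      (cellCocycle N a L (.r 1, .sr 0) : ℂ) • (symC N L : Matrix _ _ ℂ) := by
  have h := isFactorSystem_cellOp N a L
  rw [← cellOp_r_one, ← cellOp_sr_zero N a L, h, Matrix.smul_mul, h, cellCocycle_r,
    Circle.coe_one, one_smul, DihedralGroup.r_mul_sr, DihedralGroup.sr_mul_r, zero_sub,
    neg_add_cancel]

theorem exists_mulEquiv_iff_dvd (hN : 1 < N) (hL : 0 < L) :
    (∃ e : DihedralGroup N ≃* Subgroup.closure {symX N a L L, symC N L},
      (e (.r 1) : Matrix.unitaryGroup (Fin L → ZMod N) ℂ) = symX N a L L ∧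
      (e (.sr 0) : Matrix.unitaryGroup (Fin L → ZMod N) ℂ) = symC N L) ↔
      (N : ℤ) ∣ ∑ j ∈ Finset.range L, a ^ j := by
  constructor
  · rintro ⟨e, hx, hc⟩
    have h_dihedral : e (.r 1) * e (.sr 0) * e (.r 1) = e (.sr 0) := by
      rw [← map_mul, ← map_mul, DihedralGroup.r_mul_sr, DihedralGroup.sr_mul_r, zero_sub,
        neg_add_cancel]
    have h_symC : symX N a L L * symC N L * symX N a L L = symC N L := by
      simpa only [Subgroup.coe_mul, hx, hc] using congrArg Subtype.val h_dihedral
    have h_smul := symX_mul_symC_mul_symX.symm.trans (congrArg Subtype.val h_symC)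
    rw [← cellCocycle_r_one_sr_zero_eq_one_iff]
    exact Circle.ext (smul_unitary_injective (symC N L) (h_smul.trans (one_smul ℂ _).symm))
  · intro h_dvd
    have h_linear : IsFactorSystem (cellOp N a L) 1 :=
      cellCocycle_eq_one h_dvd ▸ isFactorSystem_cellOp N a L
    have h_inj : Function.Injective h_linear.linearHom :=
      (injective_iff_map_eq_one _).mpr fun g (hg : cellOp N a L g = 1) =>
        eq_one_of_cellOp_mem_phases hN hL (hg ▸ one_mem _)
    rw [← cellOp_r_one, ← cellOp_sr_zero N a L]
    exact exists_mulEquiv_closure_of_injective h_inj rfl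

theorem symX_pow_half (hN : Even N) (ha : Odd a) (n : ℕ) :
    symX N a L n ^ (N / 2) = tensorUnitary fun _ => siteOp N a 0 (halfTurn N) := by
  rw [symX, tensorUnitary_pow]
  refine congrArg tensorUnitary (funext fun i => ?_)
  rw [← zpow_natCast, ← zpow_mul]
  refine shift_zpow_congr ?_
  rw [Int.cast_mul, Int.cast_natCast, odd_mul_half hN ha.pow, pow_zero, one_mul, Int.cast_natCast,
    ZMod.natCast_zmod_val]

theorem symC_eq_tensorUnitary_siteOp (n : ℕ) :
    symC N n = tensorUnitary fun _ => siteOp N a 0 (.sr 0) := by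
  simp [symC, siteOp]

theorem not_exists_isInjectiveMPS_isSymmetricMPS (hN : Even N) (ha : Odd a) (hL : L ≠ 0) :
    ¬ ∃ (D : ℕ) (A : ZMod N → Matrix (Fin D) (Fin D) ℂ),
      IsInjectiveMPS A ∧ IsSymmetricMPS N a L A := by
  rintro ⟨D, A, hA, hsym⟩
  have hν := isFactorSystem_siteCocycle N a 0
  have h_ne := commutatorPhase_halfTurn_ne_one
    (halfTurnPhase_eq_neg_one_of_isFactorSystem_siteOp hN ha hν)
  refine h_ne (Circle.ext (hA.eq_one_of_isInvariantUpToPhase hL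
    (hν.mul_eq_commutatorPhase_smul (commute_halfTurn_sr_zero hN)) (fun k hk => ?_) fun k hk => ?_))
  · rw [← symX_pow_half (L := L) hN ha]
    exact (hsym k hk).1.pow _
  · rw [← symC_eq_tensorUnitary_siteOp]
    exact (hsym k hk).2

end Chain

end DihedralLSM

theorem mainTheorem7 (N : ℕ) [NeZero N] (hN : Even N) (a : ℤ) (ha : IsCoprime a (N : ℤ))
    (L : ℕ) (hL : 0 < L) :
    -- modulo global phases, the two symmetries generate the dihedral group of order `2 N`
    (∃ e : DihedralGroup N ≃*
        (Subgroup.closure {DihedralLSM.symX N a L L, DihedralLSM.symC N L}).map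
          (QuotientGroup.mk' (DihedralLSM.phases (Fin L → ZMod N))),
      (e (.r 1) : _ ⧸ DihedralLSM.phases (Fin L → ZMod N)) = DihedralLSM.symX N a L L ∧
      (e (.sr 0) : _ ⧸ DihedralLSM.phases (Fin L → ZMod N)) = DihedralLSM.symC N L) ∧
    -- without dividing by phases, this holds exactly when the exponents sum up to `0` modulo `N`
    ((∃ e : DihedralGroup N ≃*
        Subgroup.closure {DihedralLSM.symX N a L L, DihedralLSM.symC N L},
      (e (.r 1) : Matrix.unitaryGroup (Fin L → ZMod N) ℂ) = DihedralLSM.symX N a L L ∧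
      (e (.sr 0) : Matrix.unitaryGroup (Fin L → ZMod N) ℂ) = DihedralLSM.symC N L) ↔
      (N : ℤ) ∣ ∑ j ∈ Finset.range L, a ^ j) ∧
    -- translation by one site acts on the dihedral group by the automorphism `x ↦ x ^ a`, `c ↦ c`
    (Function.Bijective (DihedralLSM.translation N a) ∧
      ∀ (j : ℕ) (g : DihedralGroup N), DihedralLSM.siteOp N a (j + 1) g =
        DihedralLSM.siteOp N a j (DihedralLSM.translation N a g)) ∧
    -- every site carries a projective representation of nontrivial class
    (∀ j : ℕ, ∃ ν : DihedralGroup N × DihedralGroup N → Circle,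
      DihedralLSM.IsFactorSystem (DihedralLSM.siteOp N a j) ν ∧
      DihedralLSM.IsCocycle ν ∧
      DihedralLSM.halfTurnPhase ν = (-1) ^ (a ^ j) ∧
      DihedralLSM.halfTurnPhase ν = -1 ∧
      ¬ DihedralLSM.IsCoboundary ν) ∧
    -- the invariant of a class on the bonds is a sign, and depends on the class only
    (∀ ω : DihedralGroup N × DihedralGroup N → Circle, DihedralLSM.IsCocycle ω →
      (∃ m : ℤ, (m = 0 ∨ m = 1) ∧ DihedralLSM.halfTurnPhase ω = (-1) ^ m) ∧
      ∀ ω' : DihedralGroup N × DihedralGroup N → Circle, DihedralLSM.Cohomologous ω' ω →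
        DihedralLSM.halfTurnPhase ω' = DihedralLSM.halfTurnPhase ω) ∧
    -- for the class with invariant `(-1) ^ m` on the first bond, consistency reads `m (a - 1) ≡ 1`
    (∀ ω : DihedralGroup N × DihedralGroup N → Circle, DihedralLSM.IsCocycle ω →
      ∀ m : ℤ, DihedralLSM.halfTurnPhase ω = (-1) ^ m →
      ∀ (j : ℕ) (ν : DihedralGroup N × DihedralGroup N → Circle),
        DihedralLSM.IsFactorSystem (DihedralLSM.siteOp N a j) ν →
        DihedralLSM.halfTurnPhase (DihedralLSM.pullback (DihedralLSM.translation N a)^[j] ω) =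
          (-1) ^ (m * a ^ j) ∧
        (DihedralLSM.halfTurnPhase
            (DihedralLSM.pullback (DihedralLSM.translation N a)^[j + 1] ω) =
          DihedralLSM.halfTurnPhase
            (ν * DihedralLSM.pullback (DihedralLSM.translation N a)^[j] ω) ↔
          m * (a - 1) ≡ 1 [ZMOD 2])) ∧
    -- this congruence has no solution
    (¬ ∃ m : ℤ, m * (a - 1) ≡ 1 [ZMOD 2]) ∧
    -- so no classes on the two bonds next to a site are compatible with that site
    (∀ (j : ℕ) (ν : DihedralGroup N × DihedralGroup N → Circle),
      DihedralLSM.IsFactorSystem (DihedralLSM.siteOp N a j) ν →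
      ¬ ∃ ω ω' : DihedralGroup N × DihedralGroup N → Circle,
        DihedralLSM.IsCocycle ω ∧ DihedralLSM.IsCocycle ω' ∧
        DihedralLSM.Cohomologous ω' (ν * ω) ∧
        DihedralLSM.Cohomologous ω'
          (DihedralLSM.pullback (DihedralLSM.translation N a) ω)) ∧
    -- and no symmetric injective matrix product state exists, for any bond dimension
    (¬ ∃ (D : ℕ) (A : ZMod N → Matrix (Fin D) (Fin D) ℂ),
      DihedralLSM.IsInjectiveMPS A ∧ DihedralLSM.IsSymmetricMPS N a L A) := by
  have hN' : 1 < N := by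
    have := NeZero.ne N
    obtain ⟨k, rfl⟩ := hN
    omega
  have ha' := DihedralLSM.odd_of_isCoprime_of_even hN ha
  refine ⟨DihedralLSM.exists_mulEquiv_modulo_phases hN' hL,
    DihedralLSM.exists_mulEquiv_iff_dvd hN' hL,
    ⟨DihedralLSM.translation_bijective ha, fun _ => DihedralLSM.siteOp_succ⟩,
    fun j => ?site,
    fun ω hω => ⟨hω.exists_halfTurnPhase_eq_neg_one_zpow hN, fun ω' h => h.halfTurnPhase_eq hN⟩,
    fun ω _ m hm j ν hν =>
      ⟨DihedralLSM.halfTurnPhase_pullback_iterate_eq_neg_one_zpow hN ha' hm j,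
        DihedralLSM.halfTurnPhase_pullback_succ_eq_iff hN ha' hm hν⟩,
    fun ⟨m, hm⟩ => DihedralLSM.not_mul_sub_one_modEq_one ha' m hm,
    fun j ν hν ⟨ω, ω', _, _, h_site, h_translate⟩ =>
      DihedralLSM.not_cohomologous_pullback_translation hN ha' hν h_site h_translate,
    DihedralLSM.not_exists_isInjectiveMPS_isSymmetricMPS hN ha' hL.ne'⟩
  have hν := DihedralLSM.isFactorSystem_siteCocycle N a j
  have h_phase := DihedralLSM.halfTurnPhase_eq_neg_one_of_isFactorSystem_siteOp hN ha' hν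
  exact ⟨_, hν, hν.isCocycle, h_phase.trans ha'.pow.neg_one_zpow.symm, h_phase,
    DihedralLSM.not_isCoboundary_of_halfTurnPhase_eq_neg_one hN h_phase⟩
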